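/- For an uncountable cardinal $\kappa$, let $\operatorname{Slice}_\kappa$ be the assertion that there is a sequence $\{M_\alpha \mid \alpha<\kappa\}$ of transitive classes (sets or proper classes) such that 1. $M_\alpha\models ZFC$ for every $\alpha<\kappa$; 2. $\omega_1^{M_\alpha}=\omega_1$ for every $\alpha<\kappa$; 3. $2^{\delta}=\bigcup_{\alpha<\kappa}\left(2^{\delta}\cap M_\alpha\right)$ for every ordinal $\delta\in[\omega,\kappa)$; 4. $2^{\delta}\cap M_\alpha\subsetneq 2^{\delta}\cap M_\beta$ for all $\alpha<\beta<\kappa$ and every ordinal $\delta\in[\omega,\kappa)$. Here $2^\delta$ is the set of all functions $\delta\to\{0,1\}$. A subset $C$ of a partial order $\mathbb P$ is centred if every finite subset of $C$ has a lower bound in $\mathbb P$, and $\mathbb P$ is $\sigma$-centred if it is a union of countably many centred subsets. Let $\operatorname{MA}_{\omega_1}(\sigma\text{-centred})$ be the assertion that for every nonempty $\sigma$-centred partial order $\mathbb P$ and every family $\mathcal D$ of at most $\aleph_1$ dense subsets of $\mathbb P$ there is a filter $G\subseteq\mathbb P$ with $G\cap D\neq\emptyset$ for all $D\in\mathcal D$.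 **Theorem.** $\operatorname{Slice}_{\omega_1}$ implies that $\operatorname{MA}_{\omega_1}(\sigma\text{-centred})$ fails. -/

import Mathlib

universe u v

namespace SliceMA

/-! ### The language of set theory and the theory ZFC -/

/-- The only non-logical symbol of the language of set theory: a binary relation. -/
inductive SetRel : ℕ → Type
  | mem : SetRel 2

/-- The first-order language of set theory. -/
def setLang : FirstOrder.Language.{0, 0} where
  Functions := fun _ => Empty
  Relations := SetRel

/-- A type with a membership relation, seen as a structure for the language of set theory. -/
instance memStructure (A : Type v) [Membership A A] : setLang.Structure A where
  funMap := fun f _ => Empty.elim f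
  RelMap := fun r =>
    match r with
    | .mem => fun w => w 0 ∈ w 1

section Internal

/- In this section `A` is a structure for the language of set theory. All quantifiers range over
`A` and `∈` is the membership relation of `A`, so each predicate is the interpretation in `A` of
the corresponding first-order formula. -/
variable {A : Type v} [Membership A A]

/-- `A ⊨ p = (x, y)`, where `(x, y) = {{x}, {x, y}}`. -/
def IsOrdPair (p x y : A) : Prop :=
  ∀ z : A, z ∈ p ↔ (∀ w : A, w ∈ z ↔ w = x) ∨ (∀ w : A, w ∈ z ↔ w = x ∨ w = y)

/-- `A ⊨ s = x ∪ {x}`. -/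
def IsSucc (s x : A) : Prop :=
  ∀ z : A, z ∈ s ↔ z ∈ x ∨ z = x

/-- `A ⊨ a` contains the empty set and is closed under `x ↦ x ∪ {x}`. -/
def IsInductive (a : A) : Prop :=
  (∃ e : A, (∀ z : A, z ∉ e) ∧ e ∈ a) ∧ ∀ x : A, x ∈ a → ∃ s : A, IsSucc s x ∧ s ∈ a

/-- `A ⊨ w = ω`: `w` is the least inductive set. -/
def IsOmega (w : A) : Prop :=
  IsInductive w ∧ ∀ a : A, IsInductive a → ∀ x : A, x ∈ w → x ∈ a

/-- `A ⊨ f` is an injective function from `a` to `b`. -/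
def IsInjection (f a b : A) : Prop :=
  (∀ p : A, p ∈ f → ∃ x : A, x ∈ a ∧ ∃ y : A, y ∈ b ∧ IsOrdPair p x y) ∧
  (∀ x : A, x ∈ a → ∃! y : A, ∃ p : A, p ∈ f ∧ IsOrdPair p x y) ∧
  (∀ x x' y : A, (∃ p : A, p ∈ f ∧ IsOrdPair p x y) → (∃ p : A, p ∈ f ∧ IsOrdPair p x' y) →
    x = x')

/-- `A ⊨ a` is countable. -/
def IsCountable (a : A) : Prop :=
  ∃ w f : A, IsOmega w ∧ IsInjection f a w

/-- `A ⊨ a` is an ordinal: a transitive set of transitive sets. -/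
def IsOrd (a : A) : Prop :=
  (∀ x : A, x ∈ a → ∀ y : A, y ∈ x → y ∈ a) ∧
  (∀ x : A, x ∈ a → ∀ y : A, y ∈ x → ∀ z : A, z ∈ y → z ∈ x)

/-- `A ⊨ a = ω₁`: `a` is the first uncountable ordinal. -/
def IsOmegaOne (a : A) : Prop :=
  IsOrd a ∧ ¬ IsCountable a ∧ ∀ x : A, x ∈ a → IsCountable x

end Internal

/-- `A ⊨ ZFC`. In the two schemes, `φ` ranges over all first-order formulas with free variables
indexed by `ℕ`; the variables other than the displayed ones (variable `0` in Separation, variables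
`0` and `1` in Replacement) receive arbitrary parameters `w i`. -/
structure ModelsZFC (A : Type v) [Membership A A] : Prop where
  nonempty : Nonempty A
  extensionality : ∀ a b : A, (∀ x : A, x ∈ a ↔ x ∈ b) → a = b
  foundation : ∀ a : A, (∃ x : A, x ∈ a) → ∃ x : A, x ∈ a ∧ ∀ y : A, y ∈ x → y ∉ a
  pairing : ∀ a b : A, ∃ c : A, ∀ x : A, x ∈ c ↔ x = a ∨ x = b
  union : ∀ a : A, ∃ b : A, ∀ x : A, x ∈ b ↔ ∃ y : A, y ∈ a ∧ x ∈ y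
  powerset : ∀ a : A, ∃ b : A, ∀ x : A, x ∈ b ↔ ∀ y : A, y ∈ x → y ∈ a
  infinity : ∃ a : A, IsInductive a
  separation : ∀ (φ : setLang.Formula ℕ) (w : ℕ → A) (a : A),
    ∃ b : A, ∀ x : A, x ∈ b ↔ x ∈ a ∧ φ.Realize (Function.update w 0 x)
  replacement : ∀ (φ : setLang.Formula ℕ) (w : ℕ → A) (a : A),
    (∀ x : A, x ∈ a → ∃! y : A, φ.Realize (Function.update (Function.update w 0 x) 1 y)) →
    ∃ b : A, ∀ y : A,
      y ∈ b ↔ ∃ x : A, x ∈ a ∧ φ.Realize (Function.update (Function.update w 0 x) 1 y)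
  choice : ∀ a : A, (∀ x : A, x ∈ a → ∃ z : A, z ∈ x) →
    (∀ x y : A, x ∈ a → y ∈ a → (∃ z : A, z ∈ x ∧ z ∈ y) → x = y) →
    ∃ c : A, ∀ x : A, x ∈ a → ∃! z : A, z ∈ x ∧ z ∈ c

/-! ### The slicing axioms -/

/-- A class of sets, with the membership relation of the universe. -/
instance classMembership (M : Set ZFSet.{u}) : Membership M M where
  mem := fun y x => x.1 ∈ y.1

/-- A class `M` is transitive if it contains all elements of its elements. -/
def IsTransitiveClass (M : Set ZFSet.{u}) : Prop :=
  ∀ x ∈ M, ∀ y ∈ x, y ∈ M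

/-- `2 ^ δ`, the set of all functions from the von Neumann ordinal `δ` to `2 = {0, 1}`. -/
noncomputable def twoPow (δ : Ordinal.{u}) : ZFSet.{u} :=
  ZFSet.funs δ.toZFSet (2 : Ordinal.{u}).toZFSet

/-- The sequence `(M α)`, `α < κ`, witnesses the slicing axiom for `κ`. Values `M α` with
`κ ≤ α` play no role. -/
structure WitnessesSlice (κ : Cardinal.{u}) (M : Ordinal.{u} → Set ZFSet.{u}) : Prop where
  transitive : ∀ α < κ.ord, IsTransitiveClass (M α)
  models_zfc : ∀ α < κ.ord, ModelsZFC (M α)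
  omega_one : ∀ α < κ.ord,
    ∃ h : (Ordinal.omega 1).toZFSet ∈ M α, IsOmegaOne (⟨(Ordinal.omega 1).toZFSet, h⟩ : M α)
  union : ∀ δ : Ordinal.{u}, Ordinal.omega0 ≤ δ → δ < κ.ord →
    (twoPow δ : Set ZFSet.{u}) = ⋃ α ∈ Set.Iio κ.ord, ((twoPow δ : Set ZFSet.{u}) ∩ M α)
  strict : ∀ α β : Ordinal.{u}, α < β → β < κ.ord →
    ∀ δ : Ordinal.{u}, Ordinal.omega0 ≤ δ → δ < κ.ord →
      (twoPow δ : Set ZFSet.{u}) ∩ M α ⊂ (twoPow δ : Set ZFSet.{u}) ∩ M β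

/-- The slicing axiom for an uncountable cardinal `κ`. -/
def Slice (κ : Cardinal.{u}) : Prop :=
  ∃ M : Ordinal.{u} → Set ZFSet.{u}, WitnessesSlice κ M

/-! ### Martin's Axiom for σ-centred partial orders -/

/-- A subset of a partial order is centred if each of its finite subsets has a lower bound
in the partial order. -/
def IsCentred {P : Type u} [PartialOrder P] (C : Set P) : Prop :=
  ∀ F : Finset P, (F : Set P) ⊆ C → ∃ q : P, ∀ p ∈ F, q ≤ p

/-- A partial order is σ-centred if it is a union of countably many centred subsets. -/
def IsSigmaCentred (P : Type u) [PartialOrder P] : Prop :=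
  ∃ C : ℕ → Set P, (∀ n, IsCentred (C n)) ∧ ⋃ n, C n = Set.univ

/-- A subset of a partial order is dense (in the sense of forcing) if below every element there is
an element of the subset. -/
def IsDenseSubset {P : Type u} [PartialOrder P] (D : Set P) : Prop :=
  ∀ p : P, ∃ q ∈ D, q ≤ p

/-- `MA_κ(σ-centred)`: for every nonempty σ-centred partial order and every family of at most `κ`
dense subsets there is a filter that meets all members of the family. -/
def MASigmaCentred (κ : Cardinal.{u}) : Prop :=
  ∀ (P : Type u) [PartialOrder P] [Nonempty P], IsSigmaCentred P →
    ∀ 𝒟 : Set (Set P), Cardinal.mk 𝒟 ≤ κ → (∀ D ∈ 𝒟, IsDenseSubset D) →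
      ∃ G : Order.PFilter P, ∀ D ∈ 𝒟, ∃ p ∈ D, p ∈ G

end SliceMA

/-!
Suppose that `(M α)`, `α < ω₁`, is a slicing sequence and that `MA_{ω₁}(σ-centred)` holds. Pick a
new real `r α ∈ M (α + 1) \ M α` for every `α < ω₁`; these reals are pairwise distinct, because the
reals of the `M α` increase with `α`. The initial segments of a real form a branch of the binary
tree, and the sets `branch (r α) n` of pairs of `n` and an initial segment of `r α`, coded as sets of
natural numbers, form an almost disjoint family of size `ω₁`. Almost disjoint coding
(`MASigmaCentred.exists_code`), whose partial order is σ-centred, gives a single real `c` such that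
`n ∈ r (α + 1)` if and only if `c ∩ branch (r α) n` is infinite, for all `α` and `n`.

As the reals of the `M α` exhaust all reals, `c` lies in `M γ` for some `γ`. Now `M (γ + 1)` contains
`c` and `r γ`, and a transitive model of ZFC that contains both contains the real decoded from them
(`ModelsZFC.charFun_decode_mem`). Thus `r (γ + 1) ∈ M (γ + 1)`, against the choice of `r (γ + 1)`.

The arithmetic that has to be expressed inside the models is kept to addition on `ω`: the
enumeration of the finite binary strings enters through fixed reals (`digitSet` and the set of
powers of two), which also lie in `M γ` once `γ` is large enough. Addition is defined by the
existence of a finite derivation, and a transitive model contains all of these.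
-/
namespace SliceMA

/-! ### Almost disjoint coding -/

/-- Conditions for almost disjoint coding along a family `A` of sets of natural numbers: a finite
approximation `stem` to the generic set, and a finite set `side` of indices outside `X`. -/
@[ext]
structure CodingCond {I : Type u} (A : I → Set ℕ) (X : Set I) where
  stem : Finset ℕ
  side : Finset I
  side_notMem : ∀ i ∈ side, i ∉ X

namespace CodingCond

variable {I : Type u} {A : I → Set ℕ} {X : Set I}

/-- A stronger condition has larger components, and adds no point of `A i` to the stem for the
indices `i` in the side set of the weaker one. -/
instance : PartialOrder (CodingCond A X) where
  le p q := q.stem ⊆ p.stem ∧ q.side ⊆ p.side ∧ ∀ i ∈ q.side, ∀ k ∈ p.stem, k ∈ A i → k ∈ q.stem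
  le_refl p := ⟨subset_rfl, subset_rfl, fun _ _ _ h _ => h⟩
  le_trans p q r hpq hqr := ⟨hqr.1.trans hpq.1, hqr.2.1.trans hpq.2.1, fun i hi k hk hkA =>
    hqr.2.2 i hi k (hpq.2.2 i (hqr.2.1 hi) k hk hkA) hkA⟩
  le_antisymm p q hpq hqp := CodingCond.ext (hqp.1.antisymm hpq.1) (hqp.2.1.antisymm hpq.2.1)

theorem le_def {p q : CodingCond A X} : p ≤ q ↔ q.stem ⊆ p.stem ∧ q.side ⊆ p.side ∧
    ∀ i ∈ q.side, ∀ k ∈ p.stem, k ∈ A i → k ∈ q.stem := Iff.rfl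

instance : Nonempty (CodingCond A X) := ⟨⟨∅, ∅, by simp⟩⟩

/-- Finitely many conditions with the same stem are compatible: unite their side sets. -/
theorem isSigmaCentred : IsSigmaCentred (CodingCond A X) := by
  classical
  refine ⟨fun n => {p | Encodable.encode p.stem = n}, fun n F hF => ?_, ?_⟩
  · rcases F.eq_empty_or_nonempty with rfl | ⟨p₀, hp₀⟩
    · exact ⟨Classical.arbitrary _, by simp⟩
    have hstem : ∀ p ∈ F, p.stem = p₀.stem := fun p hp =>
      Encodable.encode_injective ((hF hp).trans (hF hp₀).symm)
    refine ⟨⟨p₀.stem, F.biUnion side, fun i hi => ?_⟩, fun p hp => ⟨?_, ?_, ?_⟩⟩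
    · obtain ⟨p, -, hi⟩ := Finset.mem_biUnion.1 hi
      exact p.side_notMem i hi
    · exact (hstem p hp).subset
    · exact Finset.subset_biUnion_of_mem side hp
    · intro i _ k hk _
      rw [hstem p hp]
      exact hk
  · ext p
    simp

/-- The dense sets for the index `i`: outside `X`, the index enters the side set; inside `X`, the
stem contains points of `A i` above any `m`. -/
def denseSet (A : I → Set ℕ) (X : Set I) (t : I × ℕ) : Set (CodingCond A X) :=
  {p | (t.1 ∉ X → t.1 ∈ p.side) ∧ (t.1 ∈ X → ∃ k ∈ p.stem, k ∈ A t.1 ∧ t.2 < k)}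

theorem isDenseSubset_denseSet (hinf : ∀ i, (A i).Infinite)
    (had : ∀ i j, i ≠ j → (A i ∩ A j).Finite) (t : I × ℕ) : IsDenseSubset (denseSet A X t) := by
  classical
  obtain ⟨i, m⟩ := t
  intro p
  by_cases hi : i ∈ X
  · have hfin : ((⋃ j ∈ p.side, A i ∩ A j) ∪ Set.Iic m).Finite :=
      (p.side.finite_toSet.biUnion fun j hj =>
        had i j fun h => p.side_notMem j hj (h ▸ hi)).union (Set.finite_Iic m)
    obtain ⟨k, hkA, hk⟩ := ((hinf i).sdiff hfin).nonempty
    simp only [Set.mem_union, Set.mem_iUnion, Set.mem_inter_iff, Set.mem_Iic, not_or, not_exists,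
      not_le] at hk
    refine ⟨⟨insert k p.stem, p.side, p.side_notMem⟩,
      ⟨fun h => absurd hi h, fun _ => ⟨k, Finset.mem_insert_self _ _, hkA, hk.2⟩⟩,
      Finset.subset_insert _ _, subset_rfl, fun j hj l hl hlA => ?_⟩
    rcases Finset.mem_insert.1 hl with rfl | hl
    · exact absurd ⟨hkA, hlA⟩ (hk.1 j hj)
    · exact hl
  · refine ⟨⟨p.stem, insert i p.side, fun j hj => ?_⟩,
      ⟨fun _ => Finset.mem_insert_self _ _, fun h => absurd h hi⟩,
      subset_rfl, Finset.subset_insert _ _, fun _ _ _ h _ => h⟩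
    rcases Finset.mem_insert.1 hj with rfl | hj
    · exact hi
    · exact p.side_notMem j hj

end CodingCond

/-- Under Martin's axiom for σ-centred partial orders, any subset `X` of the index set of an
almost disjoint family of size at most `κ` is coded by a single set of natural numbers. -/
theorem MASigmaCentred.exists_code {κ : Cardinal.{u}} (hMA : MASigmaCentred κ)
    (hκ : Cardinal.aleph0 ≤ κ) {I : Type u} (hI : Cardinal.mk I ≤ κ) {A : I → Set ℕ}
    (hinf : ∀ i, (A i).Infinite) (had : ∀ i j, i ≠ j → (A i ∩ A j).Finite) (X : Set I) :
    ∃ c : Set ℕ, ∀ i, (c ∩ A i).Infinite ↔ i ∈ X := by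
  have hcard : Cardinal.mk (Set.range (CodingCond.denseSet A X)) ≤ κ := by
    have h := Cardinal.mk_range_le_lift (f := CodingCond.denseSet A X)
    simp only [Cardinal.lift_id] at h
    refine h.trans ?_
    rw [Cardinal.mk_prod, Cardinal.mk_nat, Cardinal.lift_aleph0, Cardinal.lift_uzero]
    exact Cardinal.mul_le_of_le hκ hI hκ
  obtain ⟨G, hG⟩ := hMA (CodingCond A X) CodingCond.isSigmaCentred _ hcard
    (by rintro _ ⟨t, rfl⟩; exact CodingCond.isDenseSubset_denseSet hinf had t)
  refine ⟨{k | ∃ p ∈ G, k ∈ p.stem}, fun i => ⟨fun h => ?_, fun hi => ?_⟩⟩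
  · by_contra hi
    obtain ⟨p, hp, hpG⟩ := hG _ ⟨(i, 0), rfl⟩
    -- Once `i` is in a side set, no point of `A i` is added to the stem any more.
    refine h (p.stem.finite_toSet.subset ?_)
    rintro k ⟨⟨q, hqG, hkq⟩, hkA⟩
    obtain ⟨r, -, hrp, hrq⟩ := G.directed p hpG q hqG
    exact (CodingCond.le_def.1 hrp).2.2 i (hp.1 hi) k ((CodingCond.le_def.1 hrq).1 hkq) hkA
  · refine Set.infinite_of_not_bddAbove ?_
    rintro ⟨m, hm⟩
    obtain ⟨p, hp, hpG⟩ := hG _ ⟨(i, m), rfl⟩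
    obtain ⟨k, hk, hkA, hmk⟩ := hp.2 hi
    exact absurd (hm ⟨⟨p, hpG, hk⟩, hkA⟩) (not_le.2 hmk)

/-! ### Definable predicates -/

section Definability

open FirstOrder

variable {A : Type v} [Membership A A]

/-- A predicate of assignments of the variables `0, 1, 2, …` is definable if it is expressed by a
first-order formula of the language of set theory. -/
def IsDefinable (R : (ℕ → A) → Prop) : Prop :=
  ∃ φ : setLang.Formula ℕ, ∀ v, φ.Realize v ↔ R v

namespace IsDefinable

variable {R S : (ℕ → A) → Prop}

theorem mem (i j : ℕ) : IsDefinable fun v : ℕ → A => v i ∈ v j :=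
  ⟨Language.Relations.formula₂ (L := setLang) SetRel.mem (Language.Term.var i) (Language.Term.var j),
    fun _ => Iff.rfl⟩

theorem eq (i j : ℕ) : IsDefinable fun v : ℕ → A => v i = v j :=
  ⟨Language.Term.equal (Language.Term.var i) (Language.Term.var j), fun v => by
    simp [Language.Formula.realize_equal]⟩

theorem not (h : IsDefinable R) : IsDefinable fun v => ¬ R v := by
  obtain ⟨φ, hφ⟩ := h
  exact ⟨φ.not, fun v => by rw [Language.Formula.realize_not, hφ]⟩

theorem and (hR : IsDefinable R) (hS : IsDefinable S) : IsDefinable fun v => R v ∧ S v := by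
  obtain ⟨φ, hφ⟩ := hR
  obtain ⟨ψ, hψ⟩ := hS
  exact ⟨φ ⊓ ψ, fun v => by rw [Language.Formula.realize_inf, hφ, hψ]⟩

theorem imp (hR : IsDefinable R) (hS : IsDefinable S) : IsDefinable fun v => R v → S v := by
  obtain ⟨φ, hφ⟩ := hR
  obtain ⟨ψ, hψ⟩ := hS
  exact ⟨φ.imp ψ, fun v => by rw [Language.Formula.realize_imp, hφ, hψ]⟩

theorem or (hR : IsDefinable R) (hS : IsDefinable S) : IsDefinable fun v => R v ∨ S v := by
  simpa only [or_iff_not_imp_left] using hR.not.imp hS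

theorem iff (hR : IsDefinable R) (hS : IsDefinable S) : IsDefinable fun v => R v ↔ S v := by
  simpa only [iff_def] using (hR.imp hS).and (hS.imp hR)

/-- Universal quantification, in de Bruijn style: the bound variable is variable `0` of the scope,
and the other variables are shifted by one. -/
theorem all {Q : A → (ℕ → A) → Prop} (h : IsDefinable fun v => Q (v 0) fun n => v (n + 1)) :
    IsDefinable fun v => ∀ x, Q x v := by
  obtain ⟨φ, hφ⟩ := h
  let g : ℕ → ℕ ⊕ Fin 1 := fun n => n.casesOn (Sum.inr 0) Sum.inl
  refine ⟨(Language.BoundedFormula.relabel (n := 1) (k := 0) g φ).all, fun v => ?_⟩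
  rw [Language.Formula.Realize, Language.BoundedFormula.realize_all]
  refine forall_congr' fun x => ?_
  rw [Language.BoundedFormula.realize_relabel]
  have := hφ fun n => n.casesOn x v
  refine Iff.trans (Iff.of_eq ?_) this
  rw [Language.Formula.Realize]
  congr 1
  · ext n
    cases n with
    | zero => rfl
    | succ n => rfl
  · exact Subsingleton.elim _ _

theorem ex {Q : A → (ℕ → A) → Prop} (h : IsDefinable fun v => Q (v 0) fun n => v (n + 1)) :
    IsDefinable fun v => ∃ x, Q x v := by
  simpa using (all (Q := fun x v => ¬ Q x v) h.not).not

theorem isOrdPair (i j k : ℕ) : IsDefinable fun v : ℕ → A => IsOrdPair (v i) (v j) (v k) := by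
  unfold IsOrdPair
  refine all (iff (mem _ _) (or (all (iff (mem _ _) (eq _ _)))
    (all (iff (mem _ _) (or (eq _ _) (eq _ _))))))

theorem isSucc (i j : ℕ) : IsDefinable fun v : ℕ → A => IsSucc (v i) (v j) := by
  unfold IsSucc
  exact all (iff (mem _ _) (or (mem _ _) (eq _ _)))

end IsDefinable

end Definability
/-! ### Natural numbers and sets of natural numbers as sets -/

/-- The von Neumann natural number `n`. -/
noncomputable def num (n : ℕ) : ZFSet.{u} := (n : Ordinal.{u}).toZFSet

theorem mem_omega_iff {x : ZFSet.{u}} : x ∈ Ordinal.omega0.toZFSet ↔ ∃ n : ℕ, x = num n := by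
  rw [Ordinal.mem_toZFSet_iff]
  constructor
  · rintro ⟨a, ha, rfl⟩
    obtain ⟨n, rfl⟩ := Ordinal.lt_omega0.1 ha
    exact ⟨n, rfl⟩
  · rintro ⟨n, rfl⟩
    exact ⟨n, Ordinal.natCast_lt_omega0 n, rfl⟩

theorem mem_num_iff {n : ℕ} {x : ZFSet.{u}} : x ∈ num n ↔ ∃ m < n, x = num m := by
  rw [num, Ordinal.mem_toZFSet_iff]
  constructor
  · rintro ⟨a, ha, rfl⟩
    obtain ⟨m, rfl⟩ := Ordinal.lt_omega0.1 (ha.trans (Ordinal.natCast_lt_omega0 n))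
    exact ⟨m, by exact_mod_cast ha, rfl⟩
  · rintro ⟨m, hm, rfl⟩
    exact ⟨m, by exact_mod_cast hm, rfl⟩

theorem num_injective : Function.Injective num.{u} := fun m n h => by
  simpa using Ordinal.toZFSet_injective h

@[simp] theorem num_inj {m n : ℕ} : num.{u} m = num n ↔ m = n := num_injective.eq_iff

theorem num_mem_num {m n : ℕ} : num.{u} m ∈ num n ↔ m < n := by
  simp [mem_num_iff]

theorem num_succ (n : ℕ) : num.{u} (n + 1) = insert (num n) (num n) := by
  simp [num]

open Classical in
/-- The characteristic function `ω → 2` of a set of natural numbers. -/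
noncomputable def charFun (S : Set ℕ) : ZFSet.{u} :=
  ZFSet.range fun n : ℕ => ZFSet.pair (num n) (num (if n ∈ S then 1 else 0))

theorem pair_mem_charFun {S : Set ℕ} {n : ℕ} :
    ZFSet.pair (num.{u} n) (num 1) ∈ charFun S ↔ n ∈ S := by
  simp only [charFun, ZFSet.mem_range, ZFSet.pair_inj, num_inj]
  constructor
  · rintro ⟨m, rfl, h⟩
    by_contra hm
    simp [hm] at h
  · exact fun h => ⟨n, rfl, by simp [h]⟩

theorem mem_two_iff {x : ZFSet.{u}} : x ∈ (2 : Ordinal.{u}).toZFSet ↔ x = num 0 ∨ x = num 1 := by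
  change x ∈ num 2 ↔ _
  rw [mem_num_iff]
  constructor
  · rintro ⟨m, hm, rfl⟩
    interval_cases m <;> simp
  · rintro (rfl | rfl)
    · exact ⟨0, by norm_num, rfl⟩
    · exact ⟨1, by norm_num, rfl⟩

theorem charFun_mem_twoPow (S : Set ℕ) : charFun.{u} S ∈ twoPow Ordinal.omega0 := by
  classical
  rw [twoPow, ZFSet.mem_funs]
  constructor
  · intro p hp
    obtain ⟨n, rfl⟩ := ZFSet.mem_range.1 hp
    rw [ZFSet.pair_mem_prod, mem_omega_iff, mem_two_iff]
    refine ⟨⟨n, rfl⟩, ?_⟩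
    split_ifs <;> simp
  · intro z hz
    obtain ⟨n, rfl⟩ := mem_omega_iff.1 hz
    refine ⟨num (if n ∈ S then 1 else 0), ZFSet.mem_range.2 ⟨n, rfl⟩, fun y hy => ?_⟩
    obtain ⟨m, hm⟩ := ZFSet.mem_range.1 hy
    obtain ⟨hmn, rfl⟩ := ZFSet.pair_inj.1 hm
    rw [num_inj.1 hmn]

theorem exists_charFun_of_mem_twoPow {f : ZFSet.{u}} (hf : f ∈ twoPow Ordinal.omega0) :
    ∃ S : Set ℕ, f = charFun S := by
  classical
  rw [twoPow, ZFSet.mem_funs] at hf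
  have key : ∀ n : ℕ, ∀ y, ZFSet.pair (num n) y ∈ f ↔
      y = num (if ZFSet.pair (num n) (num 1) ∈ f then 1 else 0) := by
    intro n y
    obtain ⟨b, hb, hu⟩ := hf.2 (num n) (mem_omega_iff.2 ⟨n, rfl⟩)
    have hb2 := mem_two_iff.1 (ZFSet.pair_mem_prod.1 (hf.1 hb)).2
    have hiff : ∀ y, ZFSet.pair (num n) y ∈ f ↔ y = b :=
      fun y => ⟨hu y, fun h => h ▸ hb⟩
    rw [hiff, hiff]
    rcases hb2 with rfl | rfl <;> simp
  refine ⟨{n | ZFSet.pair (num n) (num 1) ∈ f}, ZFSet.ext fun p => ?_⟩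
  simp only [charFun, ZFSet.mem_range, Set.mem_ofPred_eq]
  constructor
  · intro hp
    obtain ⟨a, ha, b, hb, rfl⟩ := ZFSet.mem_prod.1 (hf.1 hp)
    obtain ⟨n, rfl⟩ := mem_omega_iff.1 ha
    exact ⟨n, by rw [(key n b).1 hp]⟩
  · rintro ⟨n, rfl⟩
    exact (key n _).2 rfl

/-! ### The decoding formula -/

section Formula

variable {A : Type v} [Membership A A]

/-- `A ⊨ f(x) = o`. -/
def HasValue (f x o : A) : Prop := ∃ p, p ∈ f ∧ IsOrdPair p x o

/-- `A ⊨ z = s + i` for natural numbers `s` and `i`: the pair `(i, z)` lies in a set of pairs each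
of which is `(0, s)` or arises from another member of the set by taking successors. -/
def IsSum (s i z : A) : Prop :=
  ∃ f q : A, q ∈ f ∧ IsOrdPair q i z ∧ ∀ q : A, q ∈ f → ∃ k u : A, IsOrdPair q k u ∧
    (((∀ x : A, x ∉ k) ∧ u = s) ∨
      ∃ k' u' q' : A, q' ∈ f ∧ IsOrdPair q' k' u' ∧ IsSucc k k' ∧ IsSucc u u')

/-- The decoding condition of `decode`, as a formula about `x` in `A`. The parameters are `ω`, `1`
and the characteristic functions of the sets involved. -/
def Decodes (w o c r e₀ e₁ p x : A) : Prop :=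
  ∀ m, m ∈ w → ∃ s, s ∈ w ∧ m ∈ s ∧ HasValue p s o ∧ (∃ z, IsSum s x z ∧ HasValue c z o) ∧
    ∀ i, i ∈ s → ∀ z, IsSum s i z →
      (HasValue e₁ z o → HasValue r i o) ∧ (HasValue e₀ z o → ¬ HasValue r i o)

namespace IsDefinable

theorem hasValue (i j k : ℕ) : IsDefinable fun v : ℕ → A => HasValue (v i) (v j) (v k) :=
  ex (and (mem _ _) (isOrdPair _ _ _))

theorem isSum (i j k : ℕ) : IsDefinable fun v : ℕ → A => IsSum (v i) (v j) (v k) :=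
  ex (ex (and (mem _ _) (and (isOrdPair _ _ _) (all (imp (mem _ _) (ex (ex (and (isOrdPair _ _ _)
    (or (and (all (not (mem _ _))) (eq _ _))
      (ex (ex (ex (and (mem _ _) (and (isOrdPair _ _ _)
        (and (isSucc _ _) (isSucc _ _))))))))))))))))

theorem decodes (i₁ i₂ i₃ i₄ i₅ i₆ i₇ i₈ : ℕ) : IsDefinable fun v : ℕ → A =>
    Decodes (v i₁) (v i₂) (v i₃) (v i₄) (v i₅) (v i₆) (v i₇) (v i₈) :=
  all (imp (mem _ _) (ex (and (mem _ _) (and (mem _ _) (and (hasValue _ _ _)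
    (and (ex (and (isSum _ _ _) (hasValue _ _ _)))
      (all (imp (mem _ _) (all (imp (isSum _ _ _)
        (and (imp (hasValue _ _ _) (hasValue _ _ _))
          (imp (hasValue _ _ _) (not (hasValue _ _ _))))))))))))))

end IsDefinable

end Formula

/-- The set decoded from `c` with the help of `r`. The members `s` of `P` are numbers of finite
partial functions from `ℕ` to `2`; the function with number `s` takes value `1` at `i < s` if
`s + i ∈ E₁`, and value `0` if `s + i ∈ E₀`. A number `n` is decoded if `s + n ∈ c` for infinitely
many numbers `s` of functions that agree with the characteristic function of `r`. -/
def decode (c r E₀ E₁ P : Set ℕ) : Set ℕ :=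
  {n | ∀ m, ∃ s, m < s ∧ s ∈ P ∧ s + n ∈ c ∧
    ∀ i < s, (s + i ∈ E₁ → i ∈ r) ∧ (s + i ∈ E₀ → i ∉ r)}

/-! ### Transitive models -/

section Model

variable {M : Set ZFSet.{u}}

/-- It suffices to compare an element of a transitive class with a set included in the class on
elements of the class. -/
theorem IsTransitiveClass.ext (hT : IsTransitiveClass M) {a : M} {b : ZFSet.{u}}
    (hb : ∀ x ∈ b, x ∈ M) (h : ∀ x : M, x ∈ a ↔ x.1 ∈ b) : a.1 = b :=
  ZFSet.ext fun x => ⟨fun hx => (h ⟨x, hT _ a.2 _ hx⟩).1 hx, fun hx => (h ⟨x, hb x hx⟩).2 hx⟩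

theorem ModelsZFC.upair_mem (hZ : ModelsZFC M) (hT : IsTransitiveClass M) {x y : ZFSet.{u}}
    (hx : x ∈ M) (hy : y ∈ M) : ({x, y} : ZFSet) ∈ M := by
  obtain ⟨c, hc⟩ := hZ.pairing ⟨x, hx⟩ ⟨y, hy⟩
  have : c.1 = {x, y} := by
    refine hT.ext (fun z hz => ?_) fun z => (hc z).trans ?_
    · rcases ZFSet.mem_pair.1 hz with rfl | rfl <;> assumption
    · simp [Subtype.ext_iff]
  exact this ▸ c.2

theorem ModelsZFC.singleton_mem (hZ : ModelsZFC M) (hT : IsTransitiveClass M) {x : ZFSet.{u}}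
    (hx : x ∈ M) : ({x} : ZFSet) ∈ M := by
  have := hZ.upair_mem hT hx hx
  rwa [ZFSet.pair_eq_singleton] at this

theorem ModelsZFC.pair_mem (hZ : ModelsZFC M) (hT : IsTransitiveClass M) {x y : ZFSet.{u}}
    (hx : x ∈ M) (hy : y ∈ M) : ZFSet.pair x y ∈ M :=
  hZ.upair_mem hT (hZ.singleton_mem hT hx) (hZ.upair_mem hT hx hy)

theorem ModelsZFC.insert_mem (hZ : ModelsZFC M) (hT : IsTransitiveClass M) {x y : ZFSet.{u}}
    (hx : x ∈ M) (hy : y ∈ M) : (insert x y : ZFSet) ∈ M := by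
  obtain ⟨c, hc⟩ := hZ.union ⟨_, hZ.upair_mem hT (hZ.singleton_mem hT hx) hy⟩
  have : c.1 = insert x y := by
    refine hT.ext (fun z hz => ?_) fun z => (hc z).trans ⟨?_, fun hz => ?_⟩
    · rcases ZFSet.mem_insert_iff.1 hz with rfl | hz
      · exact hx
      · exact hT _ hy _ hz
    · rintro ⟨t, ht, hzt⟩
      rcases ZFSet.mem_pair.1 ht with ht | ht
      · exact ZFSet.mem_insert_iff.2 (Or.inl (ZFSet.mem_singleton.1 (ht ▸ hzt)))
      · exact ZFSet.mem_insert_iff.2 (Or.inr (ht ▸ hzt))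
    · rcases ZFSet.mem_insert_iff.1 hz with h | h
      · exact ⟨⟨_, hZ.singleton_mem hT hx⟩, ZFSet.mem_pair.2 (Or.inl rfl),
          ZFSet.mem_singleton.2 h⟩
      · exact ⟨⟨_, hy⟩, ZFSet.mem_pair.2 (Or.inr rfl), h⟩
  exact this ▸ c.2

theorem ModelsZFC.isOrdPair_iff (hZ : ModelsZFC M) (hT : IsTransitiveClass M) (p x y : M) :
    IsOrdPair p x y ↔ p.1 = ZFSet.pair x.1 y.1 := by
  have h₁ : ∀ z : M, (∀ w : M, w ∈ z ↔ w = x) ↔ z.1 = {x.1} := fun z =>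
    ⟨fun h => hT.ext (fun t ht => ZFSet.mem_singleton.1 ht ▸ x.2) fun w => (h w).trans <| by
      simp [Subtype.ext_iff], fun h w => by
      rw [Subtype.ext_iff, ← ZFSet.mem_singleton, ← h]; rfl⟩
  have h₂ : ∀ z : M, (∀ w : M, w ∈ z ↔ w = x ∨ w = y) ↔ z.1 = {x.1, y.1} := fun z =>
    ⟨fun h => hT.ext (fun t ht => by
      rcases ZFSet.mem_pair.1 ht with rfl | rfl
      exacts [x.2, y.2]) fun w => (h w).trans <| by
      simp [Subtype.ext_iff], fun h w => by
      rw [Subtype.ext_iff, Subtype.ext_iff, ← ZFSet.mem_pair, ← h]; rfl⟩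
  unfold IsOrdPair
  simp only [h₁, h₂]
  constructor
  · intro h
    refine hT.ext (hT _ (hZ.pair_mem hT x.2 y.2)) fun z => (h z).trans ?_
    rw [ZFSet.pair, ZFSet.mem_pair]
  · intro h z
    change z.1 ∈ p.1 ↔ _
    rw [h, ZFSet.pair, ZFSet.mem_pair]

theorem ModelsZFC.isSucc_iff (hZ : ModelsZFC M) (hT : IsTransitiveClass M) (s x : M) :
    IsSucc s x ↔ s.1 = insert x.1 x.1 := by
  constructor
  · intro h
    refine hT.ext (hT _ (hZ.insert_mem hT x.2 x.2)) fun z => (h z).trans ?_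
    rw [ZFSet.mem_insert_iff, Subtype.ext_iff, or_comm]
    rfl
  · intro h z
    change z.1 ∈ s.1 ↔ _
    rw [h, ZFSet.mem_insert_iff, Subtype.ext_iff, or_comm]
    rfl

theorem IsTransitiveClass.num_mem (hT : IsTransitiveClass M) (hω : Ordinal.omega0.toZFSet ∈ M)
    (n : ℕ) : num n ∈ M :=
  hT _ hω _ (mem_omega_iff.2 ⟨n, rfl⟩)

/-- A transitive model contains the finite initial pieces of any sequence of its elements. -/
theorem ModelsZFC.exists_finite_range (hZ : ModelsZFC M) (hT : IsTransitiveClass M)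
    (hω : Ordinal.omega0.toZFSet ∈ M) {g : ℕ → ZFSet.{u}} (hg : ∀ n, g n ∈ M) (n : ℕ) :
    ∃ f ∈ M, ∀ x, x ∈ f ↔ ∃ k < n, x = g k := by
  induction n with
  | zero => exact ⟨num 0, hT.num_mem hω 0, fun x => by simp [mem_num_iff]⟩
  | succ n ih =>
    obtain ⟨f, hf, h⟩ := ih
    refine ⟨insert (g n) f, hZ.insert_mem hT (hg n) hf, fun x => ?_⟩
    rw [ZFSet.mem_insert_iff, h]
    constructor
    · rintro (rfl | ⟨k, hk, rfl⟩)
      · exact ⟨n, by omega, rfl⟩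
      · exact ⟨k, by omega, rfl⟩
    · rintro ⟨k, hk, rfl⟩
      rcases Nat.lt_succ_iff_lt_or_eq.1 hk with hk | rfl
      · exact Or.inr ⟨k, hk, rfl⟩
      · exact Or.inl rfl

/-- Addition of natural numbers is absolute: a derivation in the model is correct by induction on the
first coordinates of its members, and the standard derivation, being finite, lies in the model. -/
theorem ModelsZFC.isSum_iff (hZ : ModelsZFC M) (hT : IsTransitiveClass M)
    (hω : Ordinal.omega0.toZFSet ∈ M) {s i : ℕ} {x y z : M} (hx : x.1 = num s) (hy : y.1 = num i) :
    IsSum x y z ↔ z.1 = num (s + i) := by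
  unfold IsSum
  simp only [hZ.isOrdPair_iff hT, hZ.isSucc_iff hT]
  constructor
  · rintro ⟨f, q, hq, hqp, hf⟩
    have key : ∀ k : ℕ, ∀ q : M, q ∈ f → ∀ u, q.1 = ZFSet.pair (num k) u → u = num (s + k) := by
      intro k
      induction k with
      | zero =>
        intro q hq u hqu
        obtain ⟨k', u', hq', h | ⟨k₁, u₁, -, -, -, h, -⟩⟩ := hf q hq
        · obtain ⟨-, rfl⟩ := ZFSet.pair_inj.1 (hqu.symm.trans hq')
          rw [h.2, hx, add_zero]
        · obtain ⟨hk, -⟩ := ZFSet.pair_inj.1 (hqu.symm.trans hq')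
          have : k₁.1 ∈ num 0 := by rw [hk, h]; simp
          simp [mem_num_iff] at this
      | succ k ih =>
        intro q hq u hqu
        obtain ⟨k', u', hq', h | ⟨k₁, u₁, q₁, hq₁, hq₁', hk, hu⟩⟩ := hf q hq
        · obtain ⟨hk, -⟩ := ZFSet.pair_inj.1 (hqu.symm.trans hq')
          refine absurd ?_ (h.1 ⟨num 0, hT.num_mem hω 0⟩)
          change num 0 ∈ k'.1
          rw [← hk, num_mem_num]
          omega
        · obtain ⟨hk', rfl⟩ := ZFSet.pair_inj.1 (hqu.symm.trans hq')
          have hk₁ : k₁.1 = num k := by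
            have h₁ : k₁.1 ∈ num (k + 1) := by rw [hk', hk]; simp
            obtain ⟨j, -, hj⟩ := mem_num_iff.1 h₁
            rw [hj] at hk ⊢
            rw [← num_succ, ← hk', num_inj] at hk
            rw [num_inj]
            omega
          rw [hu, ih q₁ hq₁ u₁.1 (by rw [hq₁', hk₁]), ← num_succ, add_assoc]
    exact key i q hq _ (by rw [hqp, hy])
  · intro hz
    have hn := hT.num_mem hω
    have hp : ∀ k, ZFSet.pair (num k) (num (s + k)) ∈ M := fun k => hZ.pair_mem hT (hn _) (hn _)
    obtain ⟨f, hf, h⟩ := hZ.exists_finite_range hT hω hp (i + 1)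
    refine ⟨⟨f, hf⟩, ⟨_, hp i⟩, (h _).2 ⟨i, by omega, rfl⟩, by rw [hy, hz], fun q hq => ?_⟩
    obtain ⟨k, hk, hqk⟩ := (h _).1 hq
    refine ⟨⟨_, hn k⟩, ⟨_, hn (s + k)⟩, hqk, ?_⟩
    cases k with
    | zero =>
      refine Or.inl ⟨fun t ht => ?_, Subtype.ext hx.symm⟩
      obtain ⟨j, hj, -⟩ := mem_num_iff.1 ht
      omega
    | succ k =>
      exact Or.inr ⟨⟨_, hn k⟩, ⟨_, hn (s + k)⟩, ⟨_, hp k⟩, (h _).2 ⟨k, by omega, rfl⟩, rfl,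
        num_succ k, num_succ (s + k)⟩

theorem ModelsZFC.hasValue_iff (hZ : ModelsZFC M) (hT : IsTransitiveClass M)
    {S : Set ℕ} {n : ℕ} {f x o : M} (hf : f.1 = charFun S) (hx : x.1 = num n) (ho : o.1 = num 1) :
    HasValue f x o ↔ n ∈ S := by
  unfold HasValue
  simp only [hZ.isOrdPair_iff hT, hx, ho]
  rw [← pair_mem_charFun, ← hf]
  constructor
  · rintro ⟨p, hp, h⟩
    exact h ▸ hp
  · exact fun h => ⟨⟨_, hT _ f.2 _ h⟩, h, rfl⟩

theorem ModelsZFC.decodes_iff (hZ : ModelsZFC M) (hT : IsTransitiveClass M)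
    {C R E₀ E₁ P : Set ℕ} {n : ℕ} {w o c r e₀ e₁ p x : M}
    (hw : w.1 = Ordinal.omega0.toZFSet) (ho : o.1 = num 1) (hc : c.1 = charFun C)
    (hr : r.1 = charFun R) (he₀ : e₀.1 = charFun E₀) (he₁ : e₁.1 = charFun E₁)
    (hp : p.1 = charFun P) (hx : x.1 = num n) :
    Decodes w o c r e₀ e₁ p x ↔ n ∈ decode C R E₀ E₁ P := by
  have hω : Ordinal.omega0.toZFSet ∈ M := hw ▸ w.2
  have hn := hT.num_mem hω
  have hmem : ∀ y : M, y ∈ w ↔ ∃ k, y.1 = num k := fun y => by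
    rw [← mem_omega_iff, ← hw]; rfl
  simp only [Decodes, decode, Set.mem_ofPred_eq]
  constructor
  · intro h m
    obtain ⟨s, hs, hms, hps, ⟨z, hz, hcz⟩, hi⟩ := h ⟨num m, hn m⟩ ((hmem _).2 ⟨m, rfl⟩)
    obtain ⟨s', hs'⟩ := (hmem s).1 hs
    have hms' : num m ∈ s.1 := hms
    rw [hs', num_mem_num] at hms'
    rw [hZ.isSum_iff hT hω hs' hx] at hz
    refine ⟨s', hms', (hZ.hasValue_iff hT hp hs' ho).1 hps, (hZ.hasValue_iff hT hc hz ho).1 hcz,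
      fun i his => ?_⟩
    have := hi ⟨num i, hn i⟩ (show num i ∈ s.1 by rwa [hs', num_mem_num]) ⟨num (s' + i), hn _⟩
      ((hZ.isSum_iff hT hω hs' rfl).2 rfl)
    rwa [hZ.hasValue_iff hT he₁ rfl ho, hZ.hasValue_iff hT hr rfl ho,
      hZ.hasValue_iff hT he₀ rfl ho] at this
  · intro h m hm
    obtain ⟨m', hm'⟩ := (hmem m).1 hm
    obtain ⟨s, hms, hsP, hsC, hi⟩ := h m'
    refine ⟨⟨num s, hn s⟩, (hmem _).2 ⟨s, rfl⟩, ?_, (hZ.hasValue_iff hT hp rfl ho).2 hsP,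
      ⟨⟨num (s + n), hn _⟩, (hZ.isSum_iff hT hω rfl hx).2 rfl,
        (hZ.hasValue_iff hT hc rfl ho).2 hsC⟩, fun i his z hz => ?_⟩
    · change m.1 ∈ num s
      rwa [hm', num_mem_num]
    · obtain ⟨i', hi', hii'⟩ := mem_num_iff.1 (show i.1 ∈ num s from his)
      rw [hZ.isSum_iff hT hω rfl hii'] at hz
      rw [hZ.hasValue_iff hT he₁ hz ho, hZ.hasValue_iff hT hr hii' ho,
        hZ.hasValue_iff hT he₀ hz ho]
      exact hi i' hi'

/-- The reals of a transitive model of ZFC are closed under decoding. Replacement, applied to the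
map that takes `n` to the pair of `n` and its decoded value, yields the decoded function. -/
theorem ModelsZFC.charFun_decode_mem (hZ : ModelsZFC M) (hT : IsTransitiveClass M)
    (hω : Ordinal.omega0.toZFSet ∈ M) {C R E₀ E₁ P : Set ℕ} (hC : charFun C ∈ M)
    (hR : charFun R ∈ M) (hE₀ : charFun E₀ ∈ M) (hE₁ : charFun E₁ ∈ M) (hP : charFun P ∈ M) :
    charFun (decode C R E₀ E₁ P) ∈ M := by
  classical
  have hn := hT.num_mem hω
  -- Variables `0` and `1` are the argument and the value of the function; the rest are parameters.
  let params : ℕ → M := fun j => match j with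
    | 2 => ⟨_, hω⟩
    | 3 => ⟨_, hn 1⟩
    | 4 => ⟨_, hC⟩
    | 5 => ⟨_, hR⟩
    | 6 => ⟨_, hE₀⟩
    | 7 => ⟨_, hE₁⟩
    | 8 => ⟨_, hP⟩
    | _ => ⟨_, hn 0⟩
  obtain ⟨φ, hφ⟩ : IsDefinable fun v : ℕ → M =>
      (Decodes (v 2) (v 3) (v 4) (v 5) (v 6) (v 7) (v 8) (v 0) ∧ IsOrdPair (v 1) (v 0) (v 3)) ∨
      (¬ Decodes (v 2) (v 3) (v 4) (v 5) (v 6) (v 7) (v 8) (v 0) ∧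
        IsOrdPair (v 1) (v 0) (v 9)) :=
    .or (.and (.decodes ..) (.isOrdPair ..)) (.and (.not (.decodes ..)) (.isOrdPair ..))
  have key : ∀ (n : ℕ) (x y : M), x.1 = num n →
      (φ.Realize (Function.update (Function.update params 0 x) 1 y) ↔
        y.1 = ZFSet.pair (num n) (num (if n ∈ decode C R E₀ E₁ P then 1 else 0))) := by
    intro n x y hx
    rw [hφ]
    have hD : Decodes (params 2) (params 3) (params 4) (params 5) (params 6) (params 7) (params 8)
        x ↔ n ∈ decode C R E₀ E₁ P := hZ.decodes_iff hT rfl rfl rfl rfl rfl rfl rfl hx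
    simp only [Function.update_self, ne_eq, OfNat.ofNat_ne_one, OfNat.ofNat_ne_zero,
      not_false_eq_true, Function.update_of_ne, zero_ne_one, hD, hZ.isOrdPair_iff hT, hx]
    by_cases h : n ∈ decode C R E₀ E₁ P <;> simp [h, params]
  obtain ⟨b, hb⟩ := hZ.replacement φ params ⟨_, hω⟩ fun x hx => by
    obtain ⟨n, hxn⟩ := mem_omega_iff.1 (show x.1 ∈ _ from hx)
    refine ⟨⟨_, hZ.pair_mem hT (hn n) (hn (if n ∈ decode C R E₀ E₁ P then 1 else 0))⟩,
      (key n x _ hxn).2 rfl, fun y hy => Subtype.ext ((key n x y hxn).1 hy)⟩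
  have : b.1 = charFun (decode C R E₀ E₁ P) := by
    refine hT.ext (fun x hx => ?_) fun y => (hb y).trans ⟨?_, fun hy => ?_⟩
    · obtain ⟨n, rfl⟩ := ZFSet.mem_range.1 hx
      exact hZ.pair_mem hT (hn _) (hn _)
    · rintro ⟨x, hx, hy⟩
      obtain ⟨n, hxn⟩ := mem_omega_iff.1 (show x.1 ∈ _ from hx)
      exact ZFSet.mem_range.2 ⟨n, ((key n x y hxn).1 hy).symm⟩
    · obtain ⟨n, hn'⟩ := ZFSet.mem_range.1 hy
      exact ⟨⟨num n, hn n⟩, mem_omega_iff.2 ⟨n, rfl⟩, (key n _ y rfl).2 hn'.symm⟩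
  exact this ▸ b.2

end Model

/-! ### An almost disjoint family with decodable members -/

/-- The number `2 ^ m + n`, with `n < 2 ^ m`, stands for the pair of `n` and the binary string
formed by the digits of `m` below the leading one. The set `branch r n` consists of the pairs of
`n` and an initial segment of the characteristic function of `r`. -/
def branch (r : Set ℕ) (n : ℕ) : Set ℕ :=
  {x | ∃ m, x = 2 ^ m + n ∧ n < 2 ^ m ∧ ∀ i < Nat.log 2 m, m.testBit i = true ↔ i ∈ r}

/-- The positions of the digits with value `b` in the strings numbered by the powers of `2`. -/
def digitSet (b : Bool) : Set ℕ :=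
  {x | ∃ m i, x = 2 ^ m + i ∧ i < Nat.log 2 m ∧ m.testBit i = b}

/-- The code `2 ^ m + n` of a pair with `n < 2 ^ m` determines the pair. -/
theorem two_pow_add_inj {m n k l : ℕ} (hn : n < 2 ^ m) (hl : l < 2 ^ k)
    (h : 2 ^ m + n = 2 ^ k + l) : m = k ∧ n = l := by
  have key : ∀ {m n : ℕ}, n < 2 ^ m → Nat.log 2 (2 ^ m + n) = m := fun {m n} hn =>
    Nat.log_eq_of_pow_le_of_lt_pow (by omega) (by rw [pow_succ]; omega)
  have hmk : m = k := by rw [← key hn, h, key hl]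
  subst hmk
  exact ⟨rfl, by omega⟩

theorem lt_two_pow_of_lt_log {i m : ℕ} (h : i < Nat.log 2 m) : i < 2 ^ m :=
  h.trans_le ((Nat.log_le_self 2 m).trans Nat.lt_two_pow_self.le)

theorem branch_infinite (r : Set ℕ) (n : ℕ) : (branch r n).Infinite := by
  classical
  refine Set.infinite_of_not_bddAbove ?_
  rintro ⟨N, hN⟩
  -- The number with digits `r 0, …, r (l - 1), 1`, in increasing order of significance.
  obtain ⟨l, hl⟩ : ∃ l, l = N + n + 1 := ⟨_, rfl⟩
  set t := Nat.ofBits fun i : Fin l => decide ((i : ℕ) ∈ r) with ht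
  have htl : t < 2 ^ l := Nat.ofBits_lt_two_pow _
  have hlog : Nat.log 2 (2 ^ l + t) = l :=
    Nat.log_eq_of_pow_le_of_lt_pow (by omega) (by rw [pow_succ]; omega)
  have h₁ : l < 2 ^ l := Nat.lt_two_pow_self
  have h₂ : 2 ^ l + t < 2 ^ (2 ^ l + t) := Nat.lt_two_pow_self
  have hmem : 2 ^ (2 ^ l + t) + n ∈ branch r n := by
    refine ⟨_, rfl, by omega, fun i hi => ?_⟩
    rw [hlog] at hi
    rw [Nat.testBit_two_pow_add_gt hi, ht, Nat.testBit_ofBits_lt _ _ hi, decide_eq_true_iff]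
  have := hN hmem
  omega

theorem branch_inter_branch_finite {r r' : Set ℕ} {n n' : ℕ} (h : r ≠ r' ∨ n ≠ n') :
    (branch r n ∩ branch r' n').Finite := by
  by_cases hr : r = r'
  · have hn := h.resolve_left (not_not.2 hr)
    convert Set.finite_empty
    ext x
    simp only [Set.mem_empty_iff_false, iff_false]
    rintro ⟨⟨m, rfl, hm, -⟩, ⟨k, hk, hk', -⟩⟩
    exact hn (two_pow_add_inj hm hk' hk).2
  · obtain ⟨j, hj⟩ : ∃ j, ¬ (j ∈ r ↔ j ∈ r') := by
      by_contra! hc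
      exact hr (Set.ext hc)
    -- A string that is an initial segment of both has length at most `j`.
    refine (Set.finite_Iic (2 ^ 2 ^ (j + 1) + n)).subset ?_
    rintro x ⟨⟨m, rfl, hm, hmr⟩, ⟨k, hk, hk', hkr⟩⟩
    obtain ⟨rfl, -⟩ := two_pow_add_inj hm hk' hk
    have hlog : Nat.log 2 m ≤ j := by
      by_contra! hc
      exact hj ((hmr j hc).symm.trans (hkr j hc))
    have hlt : m < 2 ^ (j + 1) := Nat.lt_pow_of_log_lt (by norm_num) (by omega)
    have := Nat.pow_le_pow_right (n := 2) (by norm_num) hlt.le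
    simp only [Set.mem_Iic]
    omega

/-- Decoding with the digits of the binary strings as finite partial functions tells whether `c` has
infinitely many points on the branch with label `n`. -/
theorem mem_decode_iff {c r : Set ℕ} {n : ℕ} :
    n ∈ decode c r (digitSet false) (digitSet true) (Set.range fun m => 2 ^ m) ↔
      (c ∩ branch r n).Infinite := by
  constructor
  · intro h
    refine Set.infinite_of_not_bddAbove ?_
    rintro ⟨N, hN⟩
    -- The bound `n` ensures `n < 2 ^ m`, as the definition of `branch` requires.
    obtain ⟨_, hs, ⟨m, rfl⟩, hc, hi⟩ := h (max N n)
    obtain ⟨hs₁, hs₂⟩ := max_lt_iff.1 hs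
    have : 2 ^ m + n ≤ N := hN ⟨hc, m, rfl, hs₂, fun i him => ⟨fun hb => ?_, fun hir => ?_⟩⟩
    · dsimp only at hs₁
      omega
    · exact (hi i (lt_two_pow_of_lt_log him)).1 ⟨m, i, rfl, him, hb⟩
    · by_contra hb
      exact (hi i (lt_two_pow_of_lt_log him)).2 ⟨m, i, rfl, him, by simpa using hb⟩ hir
  · intro h N
    -- A point `2 ^ m + n` above `N + n` has `2 ^ m` above `N`.
    obtain ⟨x, ⟨hxc, m, rfl, hnm, hm⟩, hx⟩ := h.exists_gt (N + n)
    refine ⟨2 ^ m, by omega, ⟨m, rfl⟩, hxc, fun i hi => ⟨?_, ?_⟩⟩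
    · rintro ⟨k, j, hkj, hj, hb⟩
      obtain ⟨rfl, rfl⟩ := two_pow_add_inj hi (lt_two_pow_of_lt_log hj) hkj
      exact (hm i hj).1 hb
    · rintro ⟨k, j, hkj, hj, hb⟩ hir
      obtain ⟨rfl, rfl⟩ := two_pow_add_inj hi (lt_two_pow_of_lt_log hj) hkj
      rw [(hm i hj).2 hir] at hb
      cases hb

/-! ### Slicing sequences -/

namespace WitnessesSlice

variable {κ : Cardinal.{u}} {M : Ordinal.{u} → Set ZFSet.{u}}

theorem charFun_mem_mono (hM : WitnessesSlice κ M) (hκ : Ordinal.omega0 < κ.ord) {α β : Ordinal.{u}}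
    (hαβ : α ≤ β) (hβ : β < κ.ord) {S : Set ℕ} (hS : charFun S ∈ M α) : charFun S ∈ M β := by
  rcases hαβ.eq_or_lt with rfl | hlt
  · exact hS
  · exact ((hM.strict α β hlt hβ _ le_rfl hκ).1 ⟨charFun_mem_twoPow S, hS⟩).2

theorem exists_charFun_mem (hM : WitnessesSlice κ M) (hκ : Ordinal.omega0 < κ.ord) (S : Set ℕ) :
    ∃ α < κ.ord, charFun S ∈ M α := by
  have h : charFun S ∈ (twoPow Ordinal.omega0 : Set ZFSet.{u}) := charFun_mem_twoPow S
  rw [hM.union _ le_rfl hκ] at h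
  simp only [Set.mem_iUnion] at h
  obtain ⟨α, hα, -, h⟩ := h
  exact ⟨α, hα, h⟩

theorem exists_charFun_notMem (hM : WitnessesSlice κ M) (hκ : Ordinal.omega0 < κ.ord)
    {α β : Ordinal.{u}} (hαβ : α < β) (hβ : β < κ.ord) :
    ∃ S : Set ℕ, charFun S ∈ M β ∧ charFun S ∉ M α := by
  obtain ⟨f, ⟨hf, hfβ⟩, hfα⟩ := Set.exists_of_ssubset (hM.strict α β hαβ hβ _ le_rfl hκ)
  obtain ⟨S, rfl⟩ := exists_charFun_of_mem_twoPow hf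
  exact ⟨S, hfβ, fun h => hfα ⟨hf, h⟩⟩

end WitnessesSlice

end SliceMA

open SliceMA in
theorem mainTheorem1 :
    SliceMA.Slice.{u} (Cardinal.aleph 1) → ¬ SliceMA.MASigmaCentred.{u} (Cardinal.aleph 1) := by
  rintro ⟨M, hM⟩ hMA
  have hκ : Ordinal.omega0.{u} < (Cardinal.aleph 1).ord := by
    rw [Cardinal.ord_aleph]
    exact Ordinal.omega0_lt_omega_one
  have hsucc : ∀ α < (Cardinal.aleph.{u} 1).ord, α + 1 < (Cardinal.aleph 1).ord := fun α hα =>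
    (Cardinal.isSuccLimit_ord (Cardinal.aleph0_le_aleph 1)).add_one_lt hα
  have hω : ∀ α < (Cardinal.aleph.{u} 1).ord, Ordinal.omega0.toZFSet ∈ M α := fun α hα => by
    obtain ⟨h, -⟩ := hM.omega_one α hα
    exact hM.transitive α hα _ h _ (Ordinal.toZFSet_mem_toZFSet_iff.2 Ordinal.omega0_lt_omega_one)
  have hnew : ∀ α : Ordinal.{u}, ∃ S : Set ℕ, α < (Cardinal.aleph.{u} 1).ord →
      charFun S ∈ M (α + 1) ∧ charFun S ∉ M α := fun α => by
    by_cases hα : α < (Cardinal.aleph.{u} 1).ord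
    · obtain ⟨S, hS⟩ := hM.exists_charFun_notMem hκ (lt_add_one α) (hsucc α hα)
      exact ⟨S, fun _ => hS⟩
    · exact ⟨∅, fun h => absurd h hα⟩
  choose r hr using hnew
  have hrne : ∀ α β, α < β → β < (Cardinal.aleph.{u} 1).ord → r α ≠ r β := fun α β hαβ hβ h => by
    have h₁ := (hr α (hαβ.trans hβ)).1
    rw [h] at h₁
    exact (hr β hβ).2 (hM.charFun_mem_mono hκ (Order.add_one_le_of_lt hαβ) hβ h₁)
  let toOrd : (Cardinal.aleph.{u} 1).ord.ToType → Ordinal.{u} := fun i => (Ordinal.ToType.toOrd i).1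
  -- The bits of the new real of step `α + 1` are coded along the branches of that of step `α`.
  obtain ⟨c, hc⟩ := hMA.exists_code (Cardinal.aleph0_le_aleph 1)
    (I := (Cardinal.aleph.{u} 1).ord.ToType × ℕ) (A := fun t => branch (r (toOrd t.1)) t.2)
    (by
      rw [Cardinal.mk_prod, Cardinal.mk_nat, Cardinal.lift_aleph0, Cardinal.lift_uzero,
        Cardinal.mk_toType, Cardinal.card_ord]
      exact Cardinal.mul_le_of_le (Cardinal.aleph0_le_aleph 1) le_rfl (Cardinal.aleph0_le_aleph 1))
    (fun t => branch_infinite _ _)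
    (fun s t hst => by
      refine branch_inter_branch_finite ?_
      by_contra! h
      refine hst (Prod.ext ?_ h.2)
      by_contra hne
      have hne' : toOrd s.1 ≠ toOrd t.1 := fun h' =>
        hne (Ordinal.ToType.mk.symm.injective (Subtype.ext h'))
      rcases hne'.lt_or_gt with hlt | hlt
      · exact hrne _ _ hlt (Ordinal.ToType.toOrd t.1).2 h.1
      · exact hrne _ _ hlt (Ordinal.ToType.toOrd s.1).2 h.1.symm)
    {t | t.2 ∈ r (toOrd t.1 + 1)}
  have hdecode : ∀ α < (Cardinal.aleph.{u} 1).ord, decode c (r α) (digitSet false) (digitSet true)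
      (Set.range fun m => 2 ^ m) = r (α + 1) := fun α hα => by
    ext n
    have h := hc (Ordinal.ToType.mk ⟨α, hα⟩, n)
    simp only [toOrd, Ordinal.ToType.toOrd, Set.mem_ofPred_eq, OrderIso.symm_apply_apply] at h
    exact mem_decode_iff.trans h
  obtain ⟨α₁, hα₁, h₁⟩ := hM.exists_charFun_mem hκ c
  obtain ⟨α₂, hα₂, h₂⟩ := hM.exists_charFun_mem hκ (digitSet false)
  obtain ⟨α₃, hα₃, h₃⟩ := hM.exists_charFun_mem hκ (digitSet true)
  obtain ⟨α₄, hα₄, h₄⟩ := hM.exists_charFun_mem hκ (Set.range fun m => 2 ^ m)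
  obtain ⟨γ, hγ, hγ₁, hγ₂, hγ₃, hγ₄⟩ : ∃ γ < (Cardinal.aleph.{u} 1).ord,
      α₁ ≤ γ + 1 ∧ α₂ ≤ γ + 1 ∧ α₃ ≤ γ + 1 ∧ α₄ ≤ γ + 1 := by
    refine ⟨max (max α₁ α₂) (max α₃ α₄), max_lt (max_lt hα₁ hα₂) (max_lt hα₃ hα₄), ?_⟩
    have h := le_add_of_nonneg_right (a := max (max α₁ α₂) (max α₃ α₄)) (zero_le_one)
    simpa only [max_le_iff, and_assoc] using h
  have hγ' := hsucc γ hγ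
  have hmem := (hM.models_zfc _ hγ').charFun_decode_mem (hM.transitive _ hγ') (hω _ hγ')
    (hM.charFun_mem_mono hκ hγ₁ hγ' h₁) (hr γ hγ).1 (hM.charFun_mem_mono hκ hγ₂ hγ' h₂)
    (hM.charFun_mem_mono hκ hγ₃ hγ' h₃) (hM.charFun_mem_mono hκ hγ₄ hγ' h₄)
  rw [hdecode γ hγ] at hmem
  exact (hr (γ + 1) hγ').2 hmem
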